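/- Let $E$ be a real Banach lattice with order continuous norm, i.e. $\|x_\alpha\|\to 0$ for every net $x_\alpha\downarrow 0$ in $E$. The following are equivalent: (1) $E$ is a KB-space, i.e. every monotone norm bounded sequence in $E$ is norm convergent; (2) every norm bounded uo-Cauchy sequence in $E$ is un-convergent to some element of $E$; (3) every statistically norm bounded st-uo-Cauchy sequence in $E$ is st-un-convergent to some element of $E$. Here the terms are used as follows. For $D=\mathbb N$, or $D=\mathbb N\times\mathbb N$ with the product order, put $D_\alpha=\{\beta\in D:\beta\le\alpha\}$; a set $A\subseteq D$ has density $\delta(A)=d$ if $\lim_{\alpha\in D}|A\cap D_\alpha|/|D_\alpha|=d$. Let $(z_\alpha)_{\alpha\in D}$ be a net in $E$. * $z_\alpha\to z$ in order if there is a net $(p_\alpha)_{\alpha\in D}$ in $E$, decreasing with infimum $0$, such that $|z_\alpha-z|\le p_\alpha$ for all $\alpha$. $z_\alpha\to z$ statistically in order if there are a net $(p_\alpha)_{\alpha\in D}$ in $E$ with $|z_\alpha-z|\le p_\alpha$ for all $\alpha$ and a set $K\subseteq D$ with $\delta(K)=1$ such that $(p_\alpha)_{\alpha\in K}$ is decreasing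 with infimum $0$. * $z_\alpha\to z$ in the sense of uo (respectively st-uo) if for every $u\in E_+$ the net $|z_\alpha-z|\wedge u$ converges to $0$ in order (respectively statistically in order). * A sequence $(x_n)$ is uo-Cauchy (respectively st-uo-Cauchy) if the net $(x_m-x_n)_{(m,n)\in\mathbb N\times\mathbb N}$ is uo-convergent (respectively st-uo-convergent) to $0$. * A sequence $(x_n)$ is statistically norm bounded if for every $C>0$ there is $\lambda>0$ with $\delta\{n:\|\lambda x_n\|>C\}=0$. * A sequence $(x_n)$ is un-convergent to $x$ if $\||x_n-x|\wedge u\|\to 0$ for every $u\in E_+$, and st-un-convergent to $x$ if $\delta\{n:\||x_n-x|\wedge u\|\ge\varepsilon\}=0$ for every $\varepsilon>0$ and every $u\in E_+$. -/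

import Mathlib

open Filter Topology

namespace StatUnbounded

universe u v

section Density

variable {D : Type v} [Preorder D]

/-- The set `A` has asymptotic density `d` in the directed set `D`:
`|A ∩ D_a| / |D_a|` tends to `d` along `D`, where `D_a = {b | b ≤ a}`. It is used for
directed sets all of whose `D_a` are finite, namely `ℕ` (natural density) and `ℕ × ℕ` with the
product order. -/
def HasDensity (A : Set D) (d : ℝ) : Prop :=
  Tendsto (fun a : D => ((A ∩ Set.Iic a).ncard : ℝ) / ((Set.Iic a).ncard : ℝ)) atTop (𝓝 d)

end Density

section RieszSpace

variable {E : Type u} [AddCommGroup E] [Lattice E] {D : Type v} [Preorder D]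

/-- Order convergence of a net: `|x a - l| ≤ p a` for a net `p ↓ 0`. -/
def OrderConv (x : D → E) (l : E) : Prop :=
  ∃ p : D → E, Antitone p ∧ IsGLB (Set.range p) 0 ∧ ∀ a, |x a - l| ≤ p a

/-- Unbounded order (uo-) convergence of a net. -/
def UOConv (x : D → E) (l : E) : Prop :=
  ∀ u : E, 0 ≤ u → OrderConv (fun a => |x a - l| ⊓ u) 0

/-- A sequence is uo-Cauchy if the net `(x m - x n)`, indexed by `ℕ × ℕ`, is uo-convergent
to `0`. -/
def UOCauchy (x : ℕ → E) : Prop :=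
  UOConv (fun q : ℕ × ℕ => x q.1 - x q.2) 0

/-- `p ↓ 0` statistically: `p` is decreasing with infimum `0` on a set of density one. -/
def StatDecreasesToZero (p : D → E) : Prop :=
  ∃ K : Set D, HasDensity K 1 ∧ AntitoneOn p K ∧ IsGLB (p '' K) 0

/-- Statistical order convergence. -/
def StatOrderConv (x : D → E) (l : E) : Prop :=
  ∃ p : D → E, StatDecreasesToZero p ∧ ∀ a, |x a - l| ≤ p a

/-- Statistical unbounded order (st-uo-) convergence. -/
def StatUOConv (x : D → E) (l : E) : Prop :=
  ∀ u : E, 0 ≤ u → StatOrderConv (fun a => |x a - l| ⊓ u) 0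

/-- A sequence is st-uo-Cauchy if the net `(x m - x n)`, indexed by `ℕ × ℕ`, is
st-uo-convergent to `0`. -/
def StatUOCauchy (x : ℕ → E) : Prop :=
  StatUOConv (fun q : ℕ × ℕ => x q.1 - x q.2) 0

end RieszSpace

section NormedLattice

variable {E : Type u} [NormedAddCommGroup E] [Lattice E]

/-- Norm boundedness of a sequence. -/
def NormBounded (x : ℕ → E) : Prop :=
  ∃ C : ℝ, ∀ n, ‖x n‖ ≤ C

/-- Statistical norm boundedness of a sequence. -/
def StatNormBounded [NormedSpace ℝ E] (x : ℕ → E) : Prop :=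
  ∀ C : ℝ, 0 < C → ∃ r : ℝ, 0 < r ∧ HasDensity {n : ℕ | C < ‖r • x n‖} 0

/-- Unbounded norm (un-) convergence of a sequence. -/
def UNConv (x : ℕ → E) (l : E) : Prop :=
  ∀ u : E, 0 ≤ u → Tendsto (fun n => ‖|x n - l| ⊓ u‖) atTop (𝓝 0)

/-- Statistical unbounded norm (st-un-) convergence of a sequence. -/
def StatUNConv (x : ℕ → E) (l : E) : Prop :=
  ∀ ε : ℝ, 0 < ε → ∀ u : E, 0 ≤ u → HasDensity {n : ℕ | ε ≤ ‖|x n - l| ⊓ u‖} 0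

/-- The norm is order continuous: `‖x a‖ → 0` for every net `x ↓ 0`. Index sets in the universe
of `E` suffice, because every decreasing net can be replaced by its range. -/
def OrderContinuousNorm (E : Type u) [NormedAddCommGroup E] [Lattice E] : Prop :=
  ∀ (D : Type u) [Preorder D] [IsDirectedOrder D] [Nonempty D] (x : D → E),
    Antitone x → IsGLB (Set.range x) 0 → Tendsto (fun a => ‖x a‖) atTop (𝓝 0)

/-- KB-space: every monotone norm bounded sequence is norm convergent. -/
def IsKBSpace (E : Type u) [NormedAddCommGroup E] [Lattice E] : Prop :=
  ∀ x : ℕ → E, (Monotone x ∨ Antitone x) → NormBounded x → ∃ l : E, Tendsto x atTop (𝓝 l)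

end NormedLattice

end StatUnbounded

/-!
The sets of asymptotic density one form a filter, `densityFilter`, so that each statistical notion
is an ordinary one along this filter. Both nontrivial conditions on `E` become instances of one
statement about a proper filter `F ≤ atTop` on `ℕ`, with `F = atTop` or `F = densityFilter ℕ`.

A KB-space satisfies both conditions. An order continuous norm turns uo-Cauchy sequences into
un-Cauchy ones. In the statistical case it gives, for each `u`, that `‖|x m - x n| ⊓ u‖` is small
for a set of pairs `(m, n)` of density one, and a counting argument
(`exists_eventually_densityFilter_lt`) finds one `n` for which it is small for almost all `m`.
For positive sequences, un-Cauchyness makes the truncations `x n ⊓ v` converge in norm along `F`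
for every `v ≥ 0`. The limits increase with `v` and are norm bounded, so the KB property makes them
converge, and their limit is the un-limit of the sequence
(`IsKBSpace.exists_unConvAlong_of_nonneg`). The general case follows by splitting into positive
and negative parts.

Conversely, each condition implies the KB property. An increasing norm bounded sequence is
uo-Cauchy (`OrderContinuousNorm.uoCauchy_of_monotone`), hence also st-uo-Cauchy, so it has an
un-limit along `F`. Such a limit is an upper bound (`UNConvAlong.le_of_monotone`), and increasing
order bounded sequences converge in norm when the norm is order continuous
(`OrderContinuousNorm.cauchySeq_of_monotone`).
-/

namespace StatUnbounded

universe u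

/-! ### The filter of sets of density one -/

section Density

variable {D : Type*} [Preorder D] [LocallyFiniteOrderBot D]

theorem ncard_Iic_pos (a : D) : 0 < ((Set.Iic a).ncard : ℝ) := by
  exact_mod_cast (Set.ncard_pos (Set.finite_Iic a)).2 ⟨a, le_rfl⟩

theorem ncard_inter_Iic_le (A : Set D) (a : D) :
    ((A ∩ Set.Iic a).ncard : ℝ) ≤ ((Set.Iic a).ncard : ℝ) := by
  exact_mod_cast Set.ncard_le_ncard Set.inter_subset_right (Set.finite_Iic a)

/-- Only a lower bound is needed for density one, since the quotients never exceed one. -/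
theorem hasDensity_one_iff {A : Set D} :
    HasDensity A 1 ↔ ∀ η : ℝ, 0 < η →
      ∀ᶠ a in atTop, (1 - η) * ((Set.Iic a).ncard : ℝ) ≤ ((A ∩ Set.Iic a).ncard : ℝ) := by
  constructor
  · intro h η hη
    filter_upwards [h.eventually (lt_mem_nhds (show 1 - η < 1 by linarith))] with a ha
    exact ((lt_div_iff₀ (ncard_Iic_pos a)).1 ha).le
  · intro h
    refine tendsto_order.2 ⟨fun b hb => ?_, fun b hb => ?_⟩
    · filter_upwards [h ((1 - b) / 2) (by linarith)] with a ha
      rw [lt_div_iff₀ (ncard_Iic_pos a)]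
      nlinarith [ncard_Iic_pos a]
    · refine Eventually.of_forall fun a => lt_of_le_of_lt ?_ hb
      exact (div_le_one (ncard_Iic_pos a)).2 (ncard_inter_Iic_le A a)

theorem hasDensity_compl_one_iff {A : Set D} : HasDensity Aᶜ 1 ↔ HasDensity A 0 := by
  have key : ∀ a : D, ((Aᶜ ∩ Set.Iic a).ncard : ℝ) / ((Set.Iic a).ncard : ℝ)
      = 1 - ((A ∩ Set.Iic a).ncard : ℝ) / ((Set.Iic a).ncard : ℝ) := by
    intro a
    have hpos := ncard_Iic_pos a
    have h : (Aᶜ ∩ Set.Iic a).ncard + (A ∩ Set.Iic a).ncard = (Set.Iic a).ncard := by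
      rw [← Set.ncard_union_eq (disjoint_compl_left.mono Set.inter_subset_left Set.inter_subset_left)
        ((Set.finite_Iic a).subset Set.inter_subset_right)
        ((Set.finite_Iic a).subset Set.inter_subset_right), ← Set.union_inter_distrib_right,
        Set.compl_union_self, Set.univ_inter]
    have h' : ((Aᶜ ∩ Set.Iic a).ncard : ℝ) + ((A ∩ Set.Iic a).ncard : ℝ)
      = ((Set.Iic a).ncard : ℝ) := by exact_mod_cast h
    field_simp
    linarith
  unfold HasDensity
  simp_rw [key]
  constructor
  · intro h
    simpa using h.const_sub 1
  · intro h
    simpa using h.const_sub 1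

/-- The filter of sets of asymptotic density one. Statistical convergence is convergence along
this filter. -/
def densityFilter (D : Type*) [Preorder D] [LocallyFiniteOrderBot D] : Filter D where
  sets := {A | HasDensity A 1}
  univ_sets := by
    refine hasDensity_one_iff.2 fun η hη => Eventually.of_forall fun a => ?_
    rw [Set.univ_inter]
    nlinarith [ncard_Iic_pos a]
  sets_of_superset := by
    intro A B hA hAB
    refine hasDensity_one_iff.2 fun η hη => ?_
    filter_upwards [hasDensity_one_iff.1 hA η hη] with a ha
    refine ha.trans ?_
    exact_mod_cast Set.ncard_le_ncard (Set.inter_subset_inter_left _ hAB)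
      ((Set.finite_Iic a).subset Set.inter_subset_right)
  inter_sets := by
    intro A B hA hB
    refine hasDensity_one_iff.2 fun η hη => ?_
    filter_upwards [hasDensity_one_iff.1 hA (η / 2) (by linarith),
      hasDensity_one_iff.1 hB (η / 2) (by linarith)] with a ha hb
    have hfin : ∀ S : Set D, (S ∩ Set.Iic a).Finite := fun S =>
      (Set.finite_Iic a).subset Set.inter_subset_right
    have h1 := Set.ncard_union_add_ncard_inter (A ∩ Set.Iic a) (B ∩ Set.Iic a) (hfin A) (hfin B)
    rw [← Set.inter_inter_distrib_right, ← Set.union_inter_distrib_right] at h1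
    have h2 := ncard_inter_Iic_le (A ∪ B) a
    have h3 : (((A ∪ B) ∩ Set.Iic a).ncard : ℝ) + ((A ∩ B ∩ Set.Iic a).ncard : ℝ)
      = ((A ∩ Set.Iic a).ncard : ℝ) + ((B ∩ Set.Iic a).ncard : ℝ) := by exact_mod_cast h1
    nlinarith

theorem mem_densityFilter {A : Set D} : A ∈ densityFilter D ↔ HasDensity A 1 := Iff.rfl

theorem eventually_densityFilter_iff {P : D → Prop} :
    (∀ᶠ a in densityFilter D, P a) ↔ HasDensity {a | ¬ P a} 0 := by
  rw [← hasDensity_compl_one_iff]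
  have : {a | ¬ P a}ᶜ = {a | P a} := by ext; simp
  rw [this]
  rfl

instance densityFilter_neBot [IsDirectedOrder D] [Nonempty D] : (densityFilter D).NeBot := by
  refine Filter.neBot_iff.2 fun hbot => ?_
  have h : (∅ : Set D) ∈ densityFilter D := hbot ▸ mem_bot
  have h' : HasDensity (∅ : Set D) 1 := h
  have h0 : HasDensity (∅ : Set D) 0 := by
    unfold HasDensity
    simp
  exact one_ne_zero (tendsto_nhds_unique h' h0)

end Density

/-! ### Density in `ℕ` and `ℕ × ℕ` -/

theorem densityFilter_nat_le_atTop : densityFilter ℕ ≤ atTop := by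
  refine le_iInf fun k => le_principal_iff.2 ?_
  refine hasDensity_one_iff.2 fun η hη => ?_
  obtain ⟨N, hN⟩ := exists_nat_gt (k / η)
  filter_upwards [eventually_ge_atTop N] with a ha
  have h1 : Set.Ici k ∩ Set.Iic a = (Finset.Icc k a : Set ℕ) := by ext; simp
  have h2 : Set.Iic a = (Finset.Iic a : Set ℕ) := by ext; simp
  rw [h1, h2, Set.ncard_coe_finset, Set.ncard_coe_finset, Nat.card_Icc, Nat.card_Iic]
  have h3 : (a + 1 : ℝ) - k ≤ ((a + 1 - k : ℕ) : ℝ) := by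
    have : a + 1 ≤ (a + 1 - k) + k := by omega
    have : ((a + 1 : ℕ) : ℝ) ≤ ((a + 1 - k : ℕ) : ℝ) + k := by exact_mod_cast this
    push_cast at this
    linarith
  have h4 : (k : ℝ) < a * η := by
    have := (div_lt_iff₀ hη).1 hN
    have h5 : (N : ℝ) ≤ a := by exact_mod_cast ha
    nlinarith
  push_cast at *
  nlinarith

theorem HasDensity.prod {A B : Set ℕ} {d e : ℝ} (hA : HasDensity A d) (hB : HasDensity B e) :
    HasDensity (A ×ˢ B) (d * e) := by
  have h := (hA.comp (tendsto_fst (f := atTop) (g := atTop (α := ℕ)))).mul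
    (hB.comp (tendsto_snd (f := atTop (α := ℕ)) (g := atTop)))
  rw [prod_atTop_atTop_eq] at h
  refine h.congr fun q => ?_
  obtain ⟨a, b⟩ := q
  simp only [Function.comp]
  rw [div_mul_div_comm, ← Set.Iic_prod_Iic, Set.prod_inter_prod, Set.ncard_prod, Set.ncard_prod]
  push_cast
  rfl

theorem densityFilter_nat_prod_le_atTop : densityFilter (ℕ × ℕ) ≤ atTop := by
  refine le_iInf fun k => le_principal_iff.2 ?_
  have h1 : HasDensity (Set.Ici k.1) 1 := densityFilter_nat_le_atTop (Ici_mem_atTop k.1)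
  have h2 : HasDensity (Set.Ici k.2) 1 := densityFilter_nat_le_atTop (Ici_mem_atTop k.2)
  have := h1.prod h2
  rw [mul_one, Set.Ici_prod_Ici] at this
  exact this

/-- A statistical Cauchy criterion. If a function `d` satisfying the triangle inequality is
small on a set of pairs of density one, then some single point is close to almost every index.
In a large square, pigeonhole gives a column `n` that is close to most of the square's side; two
such columns `n` and `n'`, for squares of sizes `M` and `N`, are close to each other: in the rectangle
`M × N` the pairs `(i, j)` with `i` close to `n` and `j` close to `n'` are too many to avoid the
pairs on which `d` is small. Hence all these columns are close to one fixed index. -/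
theorem exists_eventually_densityFilter_lt {d : ℕ → ℕ → ℝ} (hsymm : ∀ i j, d i j = d j i)
    (htri : ∀ i j k, d i k ≤ d i j + d j k)
    (hd : ∀ ε, 0 < ε → ∀ᶠ q in densityFilter (ℕ × ℕ), d q.1 q.2 < ε) {ε : ℝ} (hε : 0 < ε) :
    ∃ n, ∀ᶠ m in densityFilter ℕ, d m n < ε := by
  set B : ℕ → Set ℕ := fun n => {m | d m n < ε / 4} with hB
  set A : Set (ℕ × ℕ) := {q | d q.1 q.2 < ε / 4} with hA
  have hAd : HasDensity A 1 := hd (ε / 4) (by linarith)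
  have hrect : ∀ a b : ℕ, ((Set.Iic (a, b)).ncard : ℝ)
      = ((Set.Iic a).ncard : ℝ) * ((Set.Iic b).ncard : ℝ) := by
    intro a b
    rw [← Set.Iic_prod_Iic, Set.ncard_prod]
    push_cast
    rfl
  have hcol : ∀ η : ℝ, 0 < η → ∀ᶠ M in (atTop : Filter ℕ),
      ∃ n, (1 - η) * ((Set.Iic M).ncard : ℝ) ≤ ((B n ∩ Set.Iic M).ncard : ℝ) := by
    intro η hη
    obtain ⟨a, ha⟩ := eventually_atTop_prod_self'.1 (hasDensity_one_iff.1 hAd η hη)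
    filter_upwards [eventually_ge_atTop a] with M haM
    have hM := ha M haM M haM
    by_contra! hcon
    have hcard : (A ∩ Set.Iic (M, M)).ncard = ∑ n ∈ Finset.Iic M, (B n ∩ Set.Iic M).ncard := by
      classical
      have hfin : (A ∩ Set.Iic (M, M)).Finite :=
        (Set.finite_Iic _).subset Set.inter_subset_right
      rw [Set.ncard_eq_toFinset_card _ hfin, Finset.card_eq_sum_card_fiberwise (f := Prod.snd)
        (t := Finset.Iic M) (by intro q hq; simp at hq ⊢; exact hq.2.2)]
      refine Finset.sum_congr rfl fun n hn => ?_
      rw [← Set.ncard_coe_finset]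
      refine (Set.ncard_image_of_injective (B n ∩ Set.Iic M)
        (f := fun m => (m, n)) (fun a b h => (Prod.mk.inj h).1)).symm.trans ?_ |>.symm
      congr 1
      ext ⟨i, j⟩
      simp only [Finset.mem_Iic] at hn
      simp only [Set.mem_image, Set.mem_inter_iff, Set.mem_Iic, Prod.mk.injEq, hB, hA,
        Set.mem_ofPred_eq, Finset.coe_filter, Set.Finite.mem_toFinset, Prod.mk_le_mk]
      constructor
      · rintro ⟨m, ⟨h1, h2⟩, rfl, rfl⟩
        exact ⟨⟨h1, h2, hn⟩, rfl⟩
      · rintro ⟨⟨h1, h2, -⟩, rfl⟩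
        exact ⟨i, ⟨h1, h2⟩, rfl, rfl⟩
    -- If every column is sparse, then so is the square.
    rw [hrect, hcard] at hM
    push_cast at hM
    have hlt : ∑ n ∈ Finset.Iic M, ((B n ∩ Set.Iic M).ncard : ℝ)
        < ∑ n ∈ Finset.Iic M, (1 - η) * ((Set.Iic M).ncard : ℝ) :=
      Finset.sum_lt_sum_of_nonempty ⟨M, by simp⟩ fun n _ => hcon n
    rw [Finset.sum_const, nsmul_eq_mul] at hlt
    have : ((Set.Iic M).ncard : ℝ) = ((Finset.Iic M).card : ℝ) := by
      rw [← Set.ncard_coe_finset, Finset.coe_Iic]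
    rw [← this] at hlt
    nlinarith
  have hquarter := hasDensity_one_iff.1 hAd (1 / 4) (by norm_num)
  obtain ⟨N₀, hN₀⟩ := eventually_atTop_prod_self'.1 hquarter
  have hclose : ∀ M ≥ N₀, ∀ N ≥ N₀, ∀ n n',
      (1 - 1 / 4) * ((Set.Iic M).ncard : ℝ) ≤ ((B n ∩ Set.Iic M).ncard : ℝ) →
      (1 - 1 / 4) * ((Set.Iic N).ncard : ℝ) ≤ ((B n' ∩ Set.Iic N).ncard : ℝ) →
      d n n' < 3 * (ε / 4) := by
    intro M hM N hN n n' hn hn'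
    by_contra! hcon
    have hdisj : Disjoint (A ∩ Set.Iic (M, N)) ((B n ×ˢ B n') ∩ Set.Iic (M, N)) := by
      refine Disjoint.mono Set.inter_subset_left Set.inter_subset_left
        (Set.disjoint_left.2 fun q hq hq' => ?_)
      have h1 : d q.1 q.2 < ε / 4 := hq
      have h2 : d q.1 n < ε / 4 := hq'.1
      have h3 : d q.2 n' < ε / 4 := hq'.2
      have h4 := htri n q.1 n'
      have h5 := htri q.1 q.2 n'
      rw [hsymm n q.1] at h4
      linarith
    have hfin : ∀ S : Set (ℕ × ℕ), (S ∩ Set.Iic (M, N)).Finite := fun S =>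
      (Set.finite_Iic _).subset Set.inter_subset_right
    have hle := ncard_inter_Iic_le (A ∪ B n ×ˢ B n') (M, N)
    rw [Set.union_inter_distrib_right, Set.ncard_union_eq hdisj (hfin _) (hfin _),
      ← Set.Iic_prod_Iic, Set.prod_inter_prod, Set.ncard_prod, Set.Iic_prod_Iic, hrect] at hle
    push_cast at hle
    have h1 := hN₀ M hM N hN
    rw [hrect] at h1
    have hM0 := ncard_Iic_pos M
    have hN0 := ncard_Iic_pos N
    -- `3/4 + (3/4)² > 1`, so the two sets cannot be disjoint.
    have h2 := mul_le_mul hn hn' (by positivity) (by positivity)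
    nlinarith [mul_pos hM0 hN0]
  obtain ⟨M₁, ⟨n₁, hn₁⟩, hM₁⟩ :=
    ((hcol (1 / 4) (by norm_num)).and (eventually_ge_atTop N₀)).exists
  refine ⟨n₁, hasDensity_one_iff.2 fun η hη => ?_⟩
  filter_upwards [hcol (min η (1 / 4)) (lt_min hη (by norm_num)), eventually_ge_atTop N₀]
    with M ⟨n, hn⟩ hM
  have hM0 := ncard_Iic_pos M
  have hdn : d n n₁ < 3 * (ε / 4) :=
    hclose M hM M₁ hM₁ n n₁ (by nlinarith [min_le_right η (1 / 4)]) hn₁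
  have hsub : B n ⊆ {m | d m n₁ < ε} := fun m (hm : d m n < ε / 4) =>
    show d m n₁ < ε by linarith [htri m n n₁]
  have hmono : ((B n ∩ Set.Iic M).ncard : ℝ) ≤ (({m | d m n₁ < ε} ∩ Set.Iic M).ncard : ℝ) := by
    exact_mod_cast Set.ncard_le_ncard (Set.inter_subset_inter_left _ hsub)
      ((Set.finite_Iic M).subset Set.inter_subset_right)
  nlinarith [min_le_left η (1 / 4)]

/-! ### Truncated distances in lattice ordered groups -/

section LatticeOrderedGroup

variable {E : Type*} [AddCommGroup E] [Lattice E] [IsOrderedAddMonoid E]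

theorem add_inf_le_inf_add_inf {a b u : E} (ha : 0 ≤ a) (hb : 0 ≤ b) (hu : 0 ≤ u) :
    (a + b) ⊓ u ≤ a ⊓ u + b ⊓ u := by
  rw [add_inf, inf_add, inf_add]
  refine le_inf (le_inf inf_le_left ?_) (le_inf ?_ ?_)
  · exact inf_le_right.trans (le_add_of_nonneg_right hb)
  · exact inf_le_right.trans (le_add_of_nonneg_left ha)
  · exact inf_le_right.trans (le_add_of_nonneg_left hu)

theorem abs_sub_inf_triangle (a b c : E) {u : E} (hu : 0 ≤ u) :
    |a - c| ⊓ u ≤ |a - b| ⊓ u + |b - c| ⊓ u := by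
  refine (inf_le_inf_right u ?_).trans (add_inf_le_inf_add_inf (abs_nonneg _) (abs_nonneg _) hu)
  simpa using abs_add_le (a - b) (b - c)

theorem abs_inf_sub_inf_le_abs_sub_inf (a b : E) {u : E} (ha : 0 ≤ a) (hb : 0 ≤ b)
    (hu : 0 ≤ u) : |a ⊓ u - b ⊓ u| ≤ |a - b| ⊓ u := by
  refine le_inf (abs_inf_sub_inf_le_abs a b u) (abs_le'.2 ⟨?_, ?_⟩)
  · exact (sub_le_self _ (le_inf hb hu)).trans inf_le_right
  · rw [neg_sub]
    exact (sub_le_self _ (le_inf ha hu)).trans inf_le_right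

/-- The truncations of `a` at the levels `v` and `v + w` differ by the part of `a` above `v`, cut
off at `w`. -/
theorem inf_add_sub_inf (a v : E) {w : E} (hw : 0 ≤ w) :
    (a - a ⊓ v) ⊓ w = a ⊓ (v + w) - a ⊓ v := by
  rw [eq_sub_iff_add_eq, inf_add, sub_add_cancel, add_inf, ← inf_assoc,
    inf_eq_left.2 (le_add_of_nonneg_left hw), add_comm w v]

end LatticeOrderedGroup

/-! ### Unbounded norm convergence along a filter and KB-spaces -/

section NormedLattice

variable {E : Type u} [NormedAddCommGroup E] [Lattice E]

/-- The sequence `x` is unbounded-norm Cauchy along the filter `F`. Comparing with a fixed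
index `n` is equivalent, by the triangle inequality, to comparing almost all pairs of indices. -/
def UNCauchyAlong (F : Filter ℕ) (x : ℕ → E) : Prop :=
  ∀ u : E, 0 ≤ u → ∀ ε : ℝ, 0 < ε → ∃ n, ∀ᶠ m in F, ‖|x m - x n| ⊓ u‖ < ε

/-- The sequence `x` is unbounded-norm convergent to `l` along the filter `F`: un-convergence
for `F = atTop`, st-un-convergence for `F = densityFilter ℕ`. -/
def UNConvAlong (F : Filter ℕ) (x : ℕ → E) (l : E) : Prop :=
  ∀ u : E, 0 ≤ u → Tendsto (fun n => ‖|x n - l| ⊓ u‖) F (𝓝 0)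

theorem UNCauchyAlong.neg {F : Filter ℕ} {x : ℕ → E} (h : UNCauchyAlong F x) :
    UNCauchyAlong F (fun n => -x n) := by
  intro u hu ε hε
  obtain ⟨n, hn⟩ := h u hu ε hε
  refine ⟨n, hn.mono fun m hm => ?_⟩
  rwa [neg_sub_neg, abs_sub_comm]

theorem statUNConv_iff {x : ℕ → E} {l : E} :
    StatUNConv x l ↔ UNConvAlong (densityFilter ℕ) x l := by
  have h : ∀ u : E, Tendsto (fun n => ‖|x n - l| ⊓ u‖) (densityFilter ℕ) (𝓝 0) ↔
      ∀ ε : ℝ, 0 < ε → HasDensity {n : ℕ | ε ≤ ‖|x n - l| ⊓ u‖} 0 := by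
    intro u
    simp_rw [Metric.tendsto_nhds, dist_zero_right, norm_norm, eventually_densityFilter_iff, not_lt]
  unfold StatUNConv UNConvAlong
  simp_rw [h]
  exact ⟨fun H u hu ε hε => H ε hε u hu, fun H ε hε u hu => H u hu ε hε⟩

/-- In a KB-space, monotone norm bounded nets converge in norm along `atTop`, since a net that is
not Cauchy contains an increasing sequence with steps bounded away from zero. -/
theorem IsKBSpace.tendsto_of_monotone [CompleteSpace E] (hKB : IsKBSpace E) {ι : Type*}
    [Preorder ι] [IsDirectedOrder ι] [Nonempty ι] {y : ι → E} (hy : Monotone y) {C : ℝ}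
    (hC : ∀ i, ‖y i‖ ≤ C) : ∃ l : E, Tendsto y atTop (𝓝 l) := by
  have hC' : ∀ ε : ℝ, 0 < ε → ∃ i, ∀ j ≥ i, dist (y j) (y i) < ε := by
    by_contra! hcon
    obtain ⟨ε, hε, h⟩ := hcon
    choose g hg hgε using h
    obtain ⟨i₀⟩ := ‹Nonempty ι›
    set s : ℕ → ι := fun n => g^[n] i₀ with hs
    have hsucc : ∀ n, s (n + 1) = g (s n) := fun n => Function.iterate_succ_apply' g n i₀
    have hmono : Monotone s := monotone_nat_of_le_succ fun n => by rw [hsucc]; exact hg _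
    obtain ⟨l, hl⟩ := hKB (y ∘ s) (Or.inl (hy.comp hmono)) ⟨C, fun n => hC _⟩
    obtain ⟨N, hN⟩ := Metric.cauchySeq_iff'.1 hl.cauchySeq (ε / 2) (by linarith)
    have h1 := hN (N + 1) (by omega)
    have h2 := hgε (s N)
    rw [← hsucc] at h2
    simp only [Function.comp] at h1
    linarith
  refine cauchySeq_tendsto_of_complete (Metric.cauchy_iff.2 ⟨inferInstance, fun ε hε => ?_⟩)
  obtain ⟨i, hi⟩ := hC' (ε / 2) (by linarith)
  refine ⟨y '' Set.Ici i, image_mem_map (Ici_mem_atTop i), ?_⟩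
  rintro _ ⟨j, hj, rfl⟩ _ ⟨k, hk, rfl⟩
  have := dist_triangle_right (y j) (y k) (y i)
  linarith [hi j hj, hi k hk]

variable [IsOrderedAddMonoid E] [HasSolidNorm E]

theorem norm_le_norm_of_nonneg_of_le {a b : E} (ha : 0 ≤ a) (hab : a ≤ b) : ‖a‖ ≤ ‖b‖ := by
  refine norm_le_norm_of_abs_le_abs ?_
  rwa [abs_of_nonneg ha, abs_of_nonneg (ha.trans hab)]

theorem norm_abs_sub_inf_triangle (a b c : E) {u : E} (hu : 0 ≤ u) :
    ‖|a - c| ⊓ u‖ ≤ ‖|a - b| ⊓ u‖ + ‖|b - c| ⊓ u‖ :=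
  (norm_le_norm_of_nonneg_of_le (le_inf (abs_nonneg _) hu) (abs_sub_inf_triangle a b c hu)).trans
    (norm_add_le _ _)

theorem UNCauchyAlong.posPart {F : Filter ℕ} {x : ℕ → E} (h : UNCauchyAlong F x) :
    UNCauchyAlong F (fun n => x n ⊔ 0) := by
  intro u hu ε hε
  obtain ⟨n, hn⟩ := h u hu ε hε
  refine ⟨n, hn.mono fun m hm => lt_of_le_of_lt ?_ hm⟩
  exact norm_le_norm_of_nonneg_of_le (le_inf (abs_nonneg _) hu)
    (inf_le_inf_right u (abs_sup_sub_sup_le_abs _ _ _))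

theorem UNConvAlong.sub {F : Filter ℕ} {x y : ℕ → E} {a b : E} (hx : UNConvAlong F x a)
    (hy : UNConvAlong F y b) : UNConvAlong F (fun n => x n - y n) (a - b) := by
  intro u hu
  have h := (hx u hu).add (hy u hu)
  rw [add_zero] at h
  refine squeeze_zero (fun _ => norm_nonneg _) (fun n => ?_) h
  have h1 := norm_abs_sub_inf_triangle (x n - y n) (a - y n) (a - b) hu
  rwa [sub_sub_sub_cancel_right, sub_sub_sub_cancel_left, abs_sub_comm b] at h1

theorem UNCauchyAlong.exists_tendsto_inf [CompleteSpace E] {F : Filter ℕ} [F.NeBot] {x : ℕ → E}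
    (hpos : ∀ n, 0 ≤ x n) (hx : UNCauchyAlong F x) {v : E} (hv : 0 ≤ v) :
    ∃ l : E, Tendsto (fun n => x n ⊓ v) F (𝓝 l) := by
  refine CompleteSpace.complete (Metric.cauchy_iff.2 ⟨inferInstance, fun ε hε => ?_⟩)
  obtain ⟨n, hn⟩ := hx v hv (ε / 2) (by linarith)
  refine ⟨Metric.ball (x n ⊓ v) (ε / 2), ?_, fun a ha b hb => ?_⟩
  · refine mem_map.2 (hn.mono fun m hm => ?_)
    rw [Metric.mem_ball, dist_eq_norm]
    refine lt_of_le_of_lt ?_ hm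
    rw [← norm_abs_eq_norm]
    exact norm_le_norm_of_nonneg_of_le (abs_nonneg _)
      (abs_inf_sub_inf_le_abs_sub_inf _ _ (hpos m) (hpos n) hv)
  · have := dist_triangle_right a b (x n ⊓ v)
    rw [Metric.mem_ball] at ha hb
    linarith

/-- The truncations `x n ⊓ v` converge along `F` for each level `v`. Their limits increase with
`v` and stay norm bounded, so in a KB-space they converge to an element `l`, and `l` is the
un-limit of `x`. -/
theorem IsKBSpace.exists_unConvAlong_of_nonneg [CompleteSpace E] (hKB : IsKBSpace E)
    {F : Filter ℕ} [F.NeBot] {x : ℕ → E} (hpos : ∀ n, 0 ≤ x n) {C : ℝ}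
    (hC : ∀ᶠ n in F, ‖x n‖ ≤ C) (hx : UNCauchyAlong F x) : ∃ l : E, UNConvAlong F x l := by
  have hlim : ∀ v : {v : E // 0 ≤ v}, ∃ l : E, Tendsto (fun n => x n ⊓ v) F (𝓝 l) :=
    fun v => hx.exists_tendsto_inf hpos v.2
  choose y hy using hlim
  have hmono : Monotone y := fun v w hvw =>
    le_of_tendsto_of_tendsto' (hy v) (hy w) fun n => inf_le_inf_left _ hvw
  have hbdd : ∀ v, ‖y v‖ ≤ C := fun v =>
    le_of_tendsto (hy v).norm (hC.mono fun n hn =>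
      (norm_le_norm_of_nonneg_of_le (le_inf (hpos n) v.2) inf_le_left).trans hn)
  have : IsDirectedOrder {v : E // 0 ≤ v} :=
    ⟨fun a b => ⟨⟨a ⊔ b, a.2.trans le_sup_left⟩, le_sup_left (a := (a : E)),
      le_sup_right (a := (a : E))⟩⟩
  have : Nonempty {v : E // 0 ≤ v} := ⟨⟨0, le_rfl⟩⟩
  obtain ⟨l, hl⟩ := hKB.tendsto_of_monotone hmono hbdd
  refine ⟨l, fun w hw => Metric.tendsto_nhds.2 fun ε hε => ?_⟩
  obtain ⟨v, hv⟩ := eventually_atTop.1 (Metric.tendsto_nhds.1 hl (ε / 6) (by linarith))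
  set v' : {v : E // 0 ≤ v} := ⟨v + w, add_nonneg v.2 hw⟩ with hv'
  have hvv' : v ≤ v' := show (v : E) ≤ v + w from le_add_of_nonneg_right hw
  have h1 := hv v le_rfl
  have h2 := hv v' hvv'
  filter_upwards [Metric.tendsto_nhds.1 (hy v) (ε / 6) (by linarith),
    Metric.tendsto_nhds.1 (hy v') (ε / 6) (by linarith)] with n h3 h4
  rw [dist_zero_right, norm_norm]
  have h5 := norm_abs_sub_inf_triangle (x n) (x n ⊓ v) l hw
  -- The part of `x n` above `v`, cut off at `w`, is close to `y (v + w) - y v`, hence to `0`.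
  have h6 : ‖|x n - x n ⊓ v| ⊓ w‖ < 4 * (ε / 6) := by
    rw [abs_of_nonneg (sub_nonneg.2 inf_le_left), inf_add_sub_inf _ _ hw, ← dist_eq_norm]
    have h8 := dist_triangle4 (x n ⊓ (v' : E)) (y v') (y v) (x n ⊓ (v : E))
    have h9 := dist_triangle_right (y v') (y v) l
    rw [dist_comm (y v)] at h8
    linarith
  have h7 : ‖|x n ⊓ v - l| ⊓ w‖ ≤ dist (x n ⊓ (v : E)) (y v) + dist (y v) l := by
    refine le_trans ?_ (dist_triangle _ _ _)
    rw [dist_eq_norm, ← norm_abs_eq_norm (x n ⊓ (v : E) - l)]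
    exact norm_le_norm_of_nonneg_of_le (le_inf (abs_nonneg _) hw) inf_le_left
  linarith

theorem IsKBSpace.exists_unConvAlong [CompleteSpace E] (hKB : IsKBSpace E)
    {F : Filter ℕ} [F.NeBot] {x : ℕ → E} {C : ℝ}
    (hC : ∀ᶠ n in F, ‖x n‖ ≤ C) (hx : UNCauchyAlong F x) : ∃ l : E, UNConvAlong F x l := by
  have hsup : ∀ a : E, ‖a ⊔ 0‖ ≤ ‖a‖ := fun a => by
    simpa using norm_sup_le_add a 0
  obtain ⟨a, ha⟩ := hKB.exists_unConvAlong_of_nonneg (fun n => le_sup_right)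
    (hC.mono fun n hn => (hsup _).trans hn) hx.posPart
  obtain ⟨b, hb⟩ := hKB.exists_unConvAlong_of_nonneg (fun n => le_sup_right)
    (hC.mono fun n hn => (hsup _).trans ((norm_neg (x n)).trans_le hn)) hx.neg.posPart
  refine ⟨a - b, ?_⟩
  have h : x = fun n => x n ⊔ 0 - -x n ⊔ 0 := funext fun n => (posPart_sub_negPart (x n)).symm
  rw [h]
  exact ha.sub hb

end NormedLattice

/-! ### From order convergence to norm convergence -/

section BanachLattice

variable {E : Type u} [NormedAddCommGroup E]

theorem StatNormBounded.exists_eventually_norm_le [NormedSpace ℝ E] {x : ℕ → E} (hx : StatNormBounded x) :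
    ∃ C : ℝ, ∀ᶠ n in densityFilter ℕ, ‖x n‖ ≤ C := by
  obtain ⟨r, hr, h⟩ := hx 1 one_pos
  refine ⟨1 / r, eventually_densityFilter_iff.2 ?_⟩
  convert h using 3 with n
  rw [not_le, norm_smul, Real.norm_of_nonneg hr.le, div_lt_iff₀' hr]

theorem NormBounded.statNormBounded [NormedSpace ℝ E] {x : ℕ → E} (hx : NormBounded x) : StatNormBounded x := by
  obtain ⟨B, hB⟩ := hx
  intro C hC
  have hB0 : 0 ≤ B := (norm_nonneg _).trans (hB 0)
  refine ⟨C / (B + 1), by positivity, ?_⟩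
  have h : ∀ᶠ n in densityFilter ℕ, ‖(C / (B + 1)) • x n‖ ≤ C := Eventually.of_forall fun n => by
    rw [norm_smul, Real.norm_of_nonneg (by positivity), div_mul_eq_mul_div,
      div_le_iff₀ (by linarith)]
    nlinarith [hB n]
  simpa using eventually_densityFilter_iff.1 h

variable [Lattice E]

/-- Order continuity of the norm for nets indexed by a directed set in `Type`, whatever the universe
of `E`. -/
theorem OrderContinuousNorm.tendsto_norm (hE : OrderContinuousNorm E) {D : Type} [Preorder D]
    [IsDirectedOrder D] [Nonempty D] {p : D → E} (hp : Antitone p)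
    (hglb : IsGLB (Set.range p) 0) : Tendsto (fun a => ‖p a‖) atTop (𝓝 0) := by
  have : IsDirectedOrder (ULift.{u} D) := ⟨fun a b => by
    obtain ⟨c, hac, hbc⟩ := exists_ge_ge a.down b.down
    exact ⟨⟨c⟩, hac, hbc⟩⟩
  have hrange : Set.range (fun a : ULift.{u} D => p a.down) = Set.range p :=
    ULift.down_surjective.range_comp p
  have h := hE (ULift.{u} D) (fun a => p a.down) (fun a b hab => hp hab) (by rwa [hrange])
  have hup : Tendsto (ULift.up : D → ULift.{u} D) atTop atTop :=
    tendsto_atTop.2 fun b => (eventually_ge_atTop b.down).mono fun a ha => ha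
  exact h.comp hup

theorem UOCauchy.statUOCauchy {x : ℕ → E} (hx : UOCauchy x) : StatUOCauchy x := by
  intro u hu
  obtain ⟨p, hp, hglb, hle⟩ := hx u hu
  exact ⟨p, ⟨Set.univ, mem_densityFilter.1 univ_mem, hp.antitoneOn _, by rwa [Set.image_univ]⟩,
    hle⟩

variable [IsOrderedAddMonoid E] [HasSolidNorm E]

theorem UOCauchy.unCauchyAlong (hE : OrderContinuousNorm E) {x : ℕ → E} (hx : UOCauchy x) :
    UNCauchyAlong atTop x := by
  intro u hu ε hε
  obtain ⟨p, hp, hglb, hle⟩ := hx u hu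
  obtain ⟨N, hN⟩ := eventually_atTop_prod_self'.1
    ((hE.tendsto_norm hp hglb).eventually (gt_mem_nhds hε))
  refine ⟨N, (eventually_ge_atTop N).mono fun m hm => ?_⟩
  have h := hle (m, N)
  simp only [sub_zero] at h
  rw [abs_of_nonneg (le_inf (abs_nonneg _) hu)] at h
  exact (norm_le_norm_of_nonneg_of_le (le_inf (abs_nonneg _) hu) h).trans_lt
    (hN m hm N le_rfl)

theorem StatUOCauchy.unCauchyAlong (hE : OrderContinuousNorm E) {x : ℕ → E}
    (hx : StatUOCauchy x) : UNCauchyAlong (densityFilter ℕ) x := by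
  intro u hu ε hε
  refine exists_eventually_densityFilter_lt (d := fun m n => ‖|x m - x n| ⊓ u‖)
    (fun i j => by rw [abs_sub_comm]) (fun i j k => norm_abs_sub_inf_triangle _ _ _ hu)
    (fun ε hε => ?_) hε
  obtain ⟨p, ⟨K, hK, hp, hglb⟩, hle⟩ := hx u hu
  have hIci : ∀ k : ℕ × ℕ, Set.Ici k ∈ densityFilter (ℕ × ℕ) := fun k =>
    densityFilter_nat_prod_le_atTop (Ici_mem_atTop k)
  have hK' : K ∈ densityFilter (ℕ × ℕ) := hK
  -- A set of density one meets every final segment, so `K` is directed.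
  have : IsDirectedOrder K := ⟨fun a b => by
    obtain ⟨c, hc, hca, hcb⟩ := (densityFilter (ℕ × ℕ)).nonempty_of_mem
      (inter_mem hK' (inter_mem (hIci a) (hIci b)))
    exact ⟨⟨c, hc⟩, hca, hcb⟩⟩
  have : Nonempty K := ((densityFilter (ℕ × ℕ)).nonempty_of_mem hK').to_subtype
  have hlim := hE.tendsto_norm (p := fun k : K => p k) (fun a b hab => hp a.2 b.2 hab)
    (by rwa [← Set.image_eq_range])
  obtain ⟨k, hk⟩ := eventually_atTop.1 (hlim.eventually (gt_mem_nhds hε))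
  filter_upwards [hK', hIci k] with q hqK hqk
  have h := hle q
  simp only [sub_zero] at h
  rw [abs_of_nonneg (le_inf (abs_nonneg _) hu)] at h
  exact (norm_le_norm_of_nonneg_of_le (le_inf (abs_nonneg _) hu) h).trans_lt
    (hk ⟨q, hqK⟩ hqk)

/-- An un-limit of an increasing sequence is an upper bound of it. -/
theorem UNConvAlong.le_of_monotone {F : Filter ℕ} [F.NeBot] (hF : F ≤ atTop) {x : ℕ → E} {l : E}
    (hx : Monotone x) (hl : UNConvAlong F x l) (m : ℕ) : x m ≤ l := by
  have h := hl ((x m - l) ⊔ 0) le_sup_right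
  have h1 : ∀ᶠ n in F, ‖(x m - l) ⊔ 0‖ ≤ ‖|x n - l| ⊓ ((x m - l) ⊔ 0)‖ := by
    filter_upwards [hF (eventually_ge_atTop m)] with n hn
    refine norm_le_norm_of_nonneg_of_le le_sup_right (le_inf (sup_le ?_ (abs_nonneg _)) le_rfl)
    exact (sub_le_sub_right (hx hn) l).trans (le_abs_self _)
  have h2 : ‖(x m - l) ⊔ 0‖ = 0 := le_antisymm (ge_of_tendsto h h1) (norm_nonneg _)
  exact sub_nonpos.1 (le_sup_left.trans (norm_eq_zero.1 h2).le)

variable [NormedSpace ℝ E] [IsOrderedModule ℝ E]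

/-! ### Monotone sequences under an order continuous norm -/

/-- The Archimedean property of a normed lattice. -/
theorem nonpos_of_forall_nsmul_le {z w : E} (h : ∀ k : ℕ, k • z ≤ w) : z ≤ 0 := by
  have hle : ∀ k : ℕ, z ≤ (1 / ((k : ℝ) + 1)) • w := by
    intro k
    have h1 := smul_le_smul_of_nonneg_left (h (k + 1)) (show 0 ≤ 1 / ((k : ℝ) + 1) by positivity)
    rwa [← Nat.cast_smul_eq_nsmul ℝ, smul_smul, Nat.cast_succ,
      one_div_mul_cancel (by positivity), one_smul] at h1
  have hlim := (tendsto_one_div_add_atTop_nhds_zero_nat (𝕜 := ℝ)).smul_const w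
  rw [zero_smul] at hlim
  exact ge_of_tendsto' hlim hle

/-- In a Banach lattice with order continuous norm, increasing order bounded sequences are norm
Cauchy: the differences `b - x n`, with `b` ranging over the upper bounds of the sequence, form a
net decreasing to zero. -/
theorem OrderContinuousNorm.cauchySeq_of_monotone (hE : OrderContinuousNorm E) {x : ℕ → E}
    (hx : Monotone x) (hbdd : BddAbove (Set.range x)) : CauchySeq x := by
  obtain ⟨v, hv⟩ := hbdd
  set U := upperBounds (Set.range x) with hU
  have hUdir : IsDirectedOrder (Uᵒᵈ × ℕ) := ⟨fun a b =>
    ⟨(OrderDual.toDual ⟨((OrderDual.ofDual a.1 : U) : E) ⊓ (OrderDual.ofDual b.1 : U), fun y hy =>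
      le_inf ((OrderDual.ofDual a.1).2 hy) ((OrderDual.ofDual b.1).2 hy)⟩, max a.2 b.2),
      ⟨inf_le_left (a := ((OrderDual.ofDual a.1 : U) : E)), le_max_left _ _⟩,
      ⟨inf_le_right (a := ((OrderDual.ofDual a.1 : U) : E)), le_max_right _ _⟩⟩⟩
  have hUne : Nonempty (Uᵒᵈ × ℕ) := ⟨(OrderDual.toDual ⟨v, hv⟩, 0)⟩
  have hglb : IsGLB (Set.range fun a : Uᵒᵈ × ℕ => ((OrderDual.ofDual a.1 : U) : E) - x a.2) 0 := by
    constructor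
    · rintro _ ⟨a, rfl⟩
      exact sub_nonneg.2 ((OrderDual.ofDual a.1).2 ⟨a.2, rfl⟩)
    · intro z hz
      have hz' : ∀ b ∈ U, ∀ n, z ≤ b - x n := fun b hb n =>
        hz ⟨(OrderDual.toDual ⟨b, hb⟩, n), rfl⟩
      -- Subtracting a lower bound `z` from an upper bound of `x` leaves an upper bound.
      have hk : ∀ k : ℕ, v - k • z ∈ U := by
        intro k
        induction k with
        | zero => simpa using hv
        | succ k ih =>
          rintro _ ⟨n, rfl⟩
          rw [succ_nsmul, ← sub_sub]
          exact le_sub_comm.1 (hz' _ ih n)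
      exact nonpos_of_forall_nsmul_le (w := v - x 0) fun k => le_sub_comm.1 (hk k ⟨0, rfl⟩)
  have h := hE (Uᵒᵈ × ℕ) _ (fun a b hab => sub_le_sub hab.1 (hx hab.2)) hglb
  refine Metric.cauchySeq_iff'.2 fun ε hε => ?_
  obtain ⟨a, ha⟩ := (h.eventually (gt_mem_nhds hε)).exists
  refine ⟨a.2, fun n hn => lt_of_le_of_lt ?_ ha⟩
  rw [dist_eq_norm]
  exact norm_le_norm_of_nonneg_of_le (sub_nonneg.2 (hx hn))
    (sub_le_sub_right ((OrderDual.ofDual a.1).2 ⟨n, rfl⟩) _)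

/-- In a Banach lattice with order continuous norm, increasing norm bounded sequences are
uo-Cauchy. For fixed `u` the remainders `p N = sup_m (x m - x N) ⊓ u` decrease to some `e ≥ 0`.
Since `e ≤ p N`, passing from `x N` to a suitable later term gains at least `e` up to a small
error, so `k` such steps show that `k • e` stays norm bounded; hence `e = 0`. -/
theorem OrderContinuousNorm.uoCauchy_of_monotone [CompleteSpace E] (hE : OrderContinuousNorm E)
    {x : ℕ → E} (hx : Monotone x) (hbdd : NormBounded x) : UOCauchy x := by
  obtain ⟨C, hC⟩ := hbdd
  intro u hu
  have hmono : ∀ N, Monotone fun m => (x m - x N) ⊓ u := fun N m m' h =>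
    inf_le_inf_right u (sub_le_sub_right (hx h) _)
  have hlim : ∀ N, ∃ l : E, Tendsto (fun m => (x m - x N) ⊓ u) atTop (𝓝 l) := fun N =>
    cauchySeq_tendsto_of_complete (hE.cauchySeq_of_monotone (hmono N)
      ⟨u, by rintro _ ⟨m, rfl⟩; exact inf_le_right⟩)
  choose p hp using hlim
  have hple : ∀ N m, (x m - x N) ⊓ u ≤ p N := fun N m => (hmono N).ge_of_tendsto (hp N) m
  have hpanti : Antitone p := fun N N' h => le_of_tendsto_of_tendsto' (hp N') (hp N) fun m =>
    inf_le_inf_right u (sub_le_sub_left (hx h) _)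
  have hp0 : ∀ N, 0 ≤ p N := fun N => by simpa [hu] using hple N N
  obtain ⟨e', he'⟩ := cauchySeq_tendsto_of_complete
    (hE.cauchySeq_of_monotone (x := fun N => -p N) (fun N N' h => neg_le_neg (hpanti h))
      ⟨0, by rintro _ ⟨m, rfl⟩; exact neg_nonpos.2 (hp0 m)⟩)
  obtain ⟨e, he⟩ : ∃ e, Tendsto p atTop (𝓝 e) := ⟨-e', by simpa using he'.neg⟩
  have hep : ∀ N, e ≤ p N := fun N => hpanti.le_of_tendsto he N
  have he0 : 0 ≤ e := ge_of_tendsto' he hp0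
  have hstep : ∀ ε : ℝ, 0 < ε → ∀ k : ℕ, ∃ N, ∃ r : E, ‖r‖ ≤ k * ε ∧
      k • e ≤ x N - x 0 + r := by
    intro ε hε k
    induction k with
    | zero => exact ⟨0, 0, by simp, by simp⟩
    | succ k ih =>
      obtain ⟨N, r, hr, hle⟩ := ih
      obtain ⟨m, hm⟩ := ((Metric.tendsto_nhds.1 (hp N) ε hε)).exists
      refine ⟨m, r + (p N - (x m - x N) ⊓ u), ?_, ?_⟩
      · rw [dist_comm, dist_eq_norm] at hm
        refine (norm_add_le _ _).trans ?_
        push_cast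
        linarith
      · have h1 : e ≤ (x m - x N) + (p N - (x m - x N) ⊓ u) := by
          refine (hep N).trans ?_
          rw [add_sub_left_comm]
          exact le_add_of_nonneg_right (sub_nonneg.2 inf_le_left)
        rw [succ_nsmul]
        refine (add_le_add hle h1).trans (le_of_eq ?_)
        abel
  have he_zero : e = 0 := by
    by_contra hne
    have hpos : 0 < ‖e‖ := norm_pos_iff.2 hne
    obtain ⟨k, hk⟩ := exists_nat_gt (4 * C / ‖e‖)
    rw [div_lt_iff₀ hpos] at hk
    obtain ⟨N, r, hr, hle⟩ := hstep (‖e‖ / 2) (by linarith) k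
    have h1 := norm_le_norm_of_nonneg_of_le (nsmul_nonneg he0 k) hle
    rw [← Nat.cast_smul_eq_nsmul ℝ, norm_smul, Real.norm_natCast] at h1
    have h2 := norm_add_le (x N - x 0) r
    have h3 := norm_sub_le (x N) (x 0)
    have h4 := hC N
    have h5 := hC 0
    linarith
  subst he_zero
  have hmin : ∀ m n, m ≤ n → |x m - x n| ⊓ u ≤ p (min m n) := fun m n h => by
    rw [abs_sub_comm, abs_of_nonneg (sub_nonneg.2 (hx h)), min_eq_left h]
    exact hple m n
  refine ⟨fun q => p (min q.1 q.2), fun a b h => hpanti (min_le_min h.1 h.2), ⟨?_, ?_⟩, ?_⟩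
  · rintro _ ⟨q, rfl⟩
    exact hp0 _
  · intro z hz
    exact ge_of_tendsto' he fun N => hz ⟨(N, N), by simp⟩
  · rintro ⟨m, n⟩
    simp only [sub_zero]
    rw [abs_of_nonneg (le_inf (abs_nonneg _) hu)]
    rcases le_total m n with h | h
    · exact hmin m n h
    · rw [abs_sub_comm, min_comm]
      exact hmin n m h

theorem OrderContinuousNorm.isKBSpace [CompleteSpace E] (hE : OrderContinuousNorm E)
    {F : Filter ℕ} [F.NeBot] (hF : F ≤ atTop)
    (h : ∀ x : ℕ → E, NormBounded x → UOCauchy x → ∃ l : E, UNConvAlong F x l) :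
    IsKBSpace E := by
  have key : ∀ x : ℕ → E, Monotone x → NormBounded x → ∃ l : E, Tendsto x atTop (𝓝 l) := by
    intro x hx hbdd
    obtain ⟨l, hl⟩ := h x hbdd (hE.uoCauchy_of_monotone hx hbdd)
    exact cauchySeq_tendsto_of_complete (hE.cauchySeq_of_monotone hx
      ⟨l, by rintro _ ⟨m, rfl⟩; exact hl.le_of_monotone hF hx m⟩)
  rintro x (hx | hx) hbdd
  · exact key x hx hbdd
  · obtain ⟨C, hC⟩ := hbdd
    obtain ⟨l, hl⟩ := key (fun n => -x n) (fun m n hmn => neg_le_neg (hx hmn))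
      ⟨C, fun n => (norm_neg _).trans_le (hC n)⟩
    exact ⟨-l, by simpa using hl.neg⟩

end BanachLattice

end StatUnbounded

theorem theorem3p6 {E : Type*} [NormedAddCommGroup E] [NormedSpace ℝ E] [Lattice E]
    [IsOrderedAddMonoid E] [IsOrderedModule ℝ E] [HasSolidNorm E] [CompleteSpace E]
    (hE : StatUnbounded.OrderContinuousNorm E) :
    List.TFAE
      [ StatUnbounded.IsKBSpace E,
        ∀ x : ℕ → E, StatUnbounded.NormBounded x → StatUnbounded.UOCauchy x →
          ∃ l : E, StatUnbounded.UNConv x l,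
        ∀ x : ℕ → E, StatUnbounded.StatNormBounded x → StatUnbounded.StatUOCauchy x →
          ∃ l : E, StatUnbounded.StatUNConv x l ] := by
  tfae_have 1 → 2 := by
    rintro hKB x ⟨C, hC⟩ hx
    exact hKB.exists_unConvAlong (Eventually.of_forall hC) (hx.unCauchyAlong hE)
  tfae_have 1 → 3 := by
    intro hKB x hbdd hx
    obtain ⟨C, hC⟩ := hbdd.exists_eventually_norm_le
    obtain ⟨l, hl⟩ := hKB.exists_unConvAlong hC (hx.unCauchyAlong hE)
    exact ⟨l, StatUnbounded.statUNConv_iff.2 hl⟩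
  tfae_have 2 → 1 := fun h => hE.isKBSpace le_rfl h
  tfae_have 3 → 1 := fun h =>
    hE.isKBSpace StatUnbounded.densityFilter_nat_le_atTop fun x hbdd hx =>
      (h x hbdd.statNormBounded hx.statUOCauchy).imp fun _ => StatUnbounded.statUNConv_iff.1
  tfae_finish
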